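/- Let $V$ be a generic complex affine plane in $\mathbb{C}^4$; that is, $V=\{Au+b : u\in\mathbb{C}^2\}$ with $A\in\mathbb{C}^{4\times 2}$ of rank $2$ and $b\in\mathbb{C}^4$, where $(A,b)$ lies outside the zero set of a certain fixed nonzero real polynomial in the real and imaginary parts of the entries of $A$ and $b$. Put $V^\times=V\cap(\mathbb{C}^\times)^4$ and let $\mathcal{C}:V^\times\to(S^1)^4$, $\mathcal{C}(z)=(z_i/|z_i|)_{1\le i\le 4}$, be the coamoeba map. Let $Z\subseteq V^\times$ be the set of critical points of $\mathcal{C}$, i.e. the points at which the (real) differential of $\mathcal{C}$ has rank less than $4$, and let $\mathcal{C}_Z=\mathcal{C}(Z)\subseteq(S^1)^4$ be the set of critical values, both with the subspace topology. Then the restriction $\mathcal{C}|_Z:Z\to\mathcal{C}_Z$ is a locally trivial fiber bundle whose fibers are open intervals: every point of $\mathcal{C}_Z$ has an open neighbourhood $U$ in $\mathcal{C}_Z$ with a homeomorphism $(\mathcal{C}|_Z)^{-1}(U)\cong U\times(0,1)$ over $U$. -/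

import Mathlib

open Module

/-- The complex algebraic torus `(ℂ^×)^4` inside `ℂ^4`. -/
def algTorus : Set (Fin 4 → ℂ) := {z | ∀ i, z i ≠ 0}

/-- The coordinatewise map `z_i ↦ z_i / |z_i|`, with values in `ℂ^4`.
On `(ℂ^×)^4` it takes its values in `(S^1)^4 ⊆ ℂ^4`, and there it is smooth. -/
noncomputable def unitCoord (z : Fin 4 → ℂ) : Fin 4 → ℂ := fun i => z i / (‖z i‖ : ℂ)

theorem unitCoord_mem {z : Fin 4 → ℂ} (hz : z ∈ algTorus) (i : Fin 4) :
    unitCoord z i ∈ Submonoid.unitSphere ℂ := by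
  have h : ‖z i‖ ≠ 0 := norm_ne_zero_iff.mpr (hz i)
  have h1 : ‖unitCoord z i‖ = 1 := by simp [unitCoord, h]
  exact mem_sphere_zero_iff_norm.mpr h1

/-- The map `Arg : (ℂ^×)^4 → (S^1)^4`. -/
noncomputable def torusArg (z : algTorus) : Fin 4 → Circle :=
  fun i => ⟨unitCoord z.1 i, unitCoord_mem z.2 i⟩

/-- `V^× = V ∩ (ℂ^×)^4`. -/
def torusPart (V : AffineSubspace ℂ (Fin 4 → ℂ)) : Set (Fin 4 → ℂ) :=
  {z | z ∈ V ∧ z ∈ algTorus}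

/-- The coamoeba map of `V`: the restriction of `Arg` to `V^×`. -/
noncomputable def coamoebaMap (V : AffineSubspace ℂ (Fin 4 → ℂ)) (z : torusPart V) :
    Fin 4 → Circle :=
  torusArg ⟨z.1, z.2.2⟩

/-- The real rank at `z` of the derivative of the coamoeba map of `V`. The tangent space of `V^×`
at `z` is the direction of `V`; since `(S^1)^4` is a submanifold of `ℂ^4`, the rank is the same
whether the derivative is taken with values in the tangent space of `(S^1)^4` or in `ℂ^4`. -/
noncomputable def coamoebaRank (V : AffineSubspace ℂ (Fin 4 → ℂ)) (z : torusPart V) : ℕ :=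
  finrank ℝ ((V.direction.restrictScalars ℝ).map
    (fderiv ℝ unitCoord z.1 : (Fin 4 → ℂ) →ₗ[ℝ] (Fin 4 → ℂ)))

/-- The set `Z` of critical points of the coamoeba map: the points of `V^×` at which its
derivative is not onto the (real four-dimensional) tangent space of `(S^1)^4`. -/
def criticalLocus (V : AffineSubspace ℂ (Fin 4 → ℂ)) : Set (torusPart V) :=
  {z | coamoebaRank V z < 4}

/-- The set `C_Z` of critical values of the coamoeba map, a subspace of `(S^1)^4`. -/
def criticalValues (V : AffineSubspace ℂ (Fin 4 → ℂ)) : Set (Fin 4 → Circle) :=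
  coamoebaMap V '' criticalLocus V

/-- The restriction `Z → C_Z` of the coamoeba map. -/
noncomputable def criticalProj (V : AffineSubspace ℂ (Fin 4 → ℂ)) (z : criticalLocus V) :
    criticalValues V :=
  ⟨coamoebaMap V z.1, Set.mem_image_of_mem _ z.2⟩

/-- `p : E → B` is a locally trivial fiber bundle with typical fiber `F`: every point of `B` has an
open neighbourhood `U` with a homeomorphism `p ⁻¹' U ≃ U × F` over `U`. -/
def IsLocallyTrivialBundle (F : Type*) [TopologicalSpace F] {E B : Type*} [TopologicalSpace E]
    [TopologicalSpace B] (p : E → B) : Prop :=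
  ∀ b : B, ∃ e : Bundle.Trivialization F p, b ∈ e.baseSet

/-- The real coordinates (real parts, then imaginary parts of all entries) of the affine map
`u ↦ A u + b` from `ℂ^2` to `ℂ^4`. -/
def realCoords (A : Matrix (Fin 4) (Fin 2) ℂ) (b : Fin 4 → ℂ) :
    ((Fin 4 × Fin 2) ⊕ Fin 4) ⊕ ((Fin 4 × Fin 2) ⊕ Fin 4) → ℝ :=
  Sum.elim (Sum.elim (fun p => (A p.1 p.2).re) (fun i => (b i).re))
    (Sum.elim (fun p => (A p.1 p.2).im) (fun i => (b i).im))

/-- `Q` holds for a generic affine plane in `ℂ^4`: it holds for each plane `V = {A u + b}` whose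
parameters `(A, b)` lie outside the zero set of some fixed nonzero real polynomial in the real
and imaginary parts of the entries of `A` and `b`. -/
def HoldsForGenericPlane (Q : AffineSubspace ℂ (Fin 4 → ℂ) → Prop) : Prop :=
  ∃ P : MvPolynomial (((Fin 4 × Fin 2) ⊕ Fin 4) ⊕ ((Fin 4 × Fin 2) ⊕ Fin 4)) ℝ, P ≠ 0 ∧
    ∀ (V : AffineSubspace ℂ (Fin 4 → ℂ)) (A : Matrix (Fin 4) (Fin 2) ℂ) (b : Fin 4 → ℂ),
      finrank ℂ V.direction = 2 →
      (V : Set (Fin 4 → ℂ)) = Set.range (fun u : Fin 2 → ℂ => A.mulVec u + b) →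
      MvPolynomial.eval (realCoords A b) P ≠ 0 →
      Q V

/-! ### The kernel of the derivative -/

/-! The derivative of `unitCoord` at a point with argument `θ` kills exactly the vectors `(θ_i x_i)`
with `x` real. By rank-nullity the point is critical iff `L_θ = {x real | rotate θ x ∈ V.direction}`
is nonzero (`mem_criticalLocus_iff`). This depends on `θ` alone, so over a critical value the fiber
is all of `{x > 0 | rotate θ x ∈ V}`, a slice of the positive orthant by a translate of `L_θ`.

Genericity makes `L_θ` a line: two independent real vectors in it would force the product `p₀₁ p₂₃
conj (p₀₂ p₁₃)` of minors of `A` to be real (`mul_eq_mul_of_minors`). Each fiber is then an open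
interval on a line.

For local triviality, the line is parametrized by a coordinate `x k` that is nonconstant along it,
with base point and direction continuous in `θ` (`exists_continuousOn_line`). An end of the interval
may lie at infinity, so the ends are recorded by their reciprocals, which are finite and continuous,
and `stretch` and `shrink` identify the interval with `ℝ` (`exists_trivialization`). -/

theorem differentiableAt_div_norm {z : ℂ} (hz : z ≠ 0) :
    DifferentiableAt ℝ (fun w : ℂ => w / (‖w‖ : ℂ)) z := by
  have h1 : DifferentiableAt ℝ (fun w : ℂ => ((‖w‖ : ℝ) : ℂ)) z :=
    Complex.ofRealCLM.differentiableAt.comp z (differentiableAt_id.norm ℂ hz)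
  have h2 : ((‖z‖ : ℝ) : ℂ) ≠ 0 := by simpa using hz
  simp only [div_eq_mul_inv]
  exact differentiableAt_id.fun_mul (h1.fun_inv h2)

/-- The product rule applied to `w = (w / |w|) * |w|`. -/
theorem fderiv_div_norm {z : ℂ} (hz : z ≠ 0) (v : ℂ) :
    fderiv ℝ (fun w : ℂ => w / (‖w‖ : ℂ)) z v * ‖z‖ +
      z / ‖z‖ * (fderiv ℝ (fun w : ℂ => ‖w‖) z v : ℝ) = v := by
  have hu := (differentiableAt_div_norm hz).hasFDerivAt
  have hn : HasFDerivAt (fun w : ℂ => ((‖w‖ : ℝ) : ℂ))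
      (Complex.ofRealCLM.comp (fderiv ℝ (fun w : ℂ => ‖w‖) z)) z :=
    Complex.ofRealCLM.hasFDerivAt.comp z (differentiableAt_id.norm ℂ hz).hasFDerivAt
  have hm := hu.mul hn
  have he : ((fun w : ℂ => w / (‖w‖ : ℂ)) * fun w : ℂ => ((‖w‖ : ℝ) : ℂ)) = id := by
    funext w
    by_cases hw : w = 0
    · simp [hw]
    · have : ((‖w‖ : ℝ) : ℂ) ≠ 0 := by simpa using hw
      simp [div_mul_cancel₀ _ this]
  rw [he] at hm
  have h := congrArg (fun f : ℂ →L[ℝ] ℂ => f v) (hm.unique (hasFDerivAt_id z))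
  simp only [add_apply, smul_apply,
    ContinuousLinearMap.comp_apply, smul_eq_mul, Complex.ofRealCLM_apply,
    ContinuousLinearMap.id_apply] at h
  rw [add_comm, mul_comm (fderiv ℝ (fun w : ℂ => w / (‖w‖ : ℂ)) z v)]
  exact h

theorem fderiv_div_norm_eq_zero_iff {z : ℂ} (hz : z ≠ 0) (v : ℂ) :
    fderiv ℝ (fun w : ℂ => w / (‖w‖ : ℂ)) z v = 0 ↔ ∃ t : ℝ, v = z / ‖z‖ * t := by
  have hn : ((‖z‖ : ℝ) : ℂ) ≠ 0 := by simpa using hz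
  constructor
  · intro h
    have := fderiv_div_norm hz v
    rw [h, zero_mul, zero_add] at this
    exact ⟨_, this.symm⟩
  · rintro ⟨t, rfl⟩
    have hself : fderiv ℝ (fun w : ℂ => w / (‖w‖ : ℂ)) z z = 0 := by
      have := fderiv_div_norm hz z
      have hd : DifferentiableAt ℝ (fun w : ℂ => ‖w‖) z := differentiableAt_id.norm ℂ hz
      rw [hd.fderiv_norm_self, div_mul_cancel₀ _ hn] at this
      simpa [hz] using this
    have : z / ‖z‖ * t = (t / ‖z‖ : ℝ) • z := by
      rw [Complex.real_smul]; push_cast; ring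
    rw [this, map_smul, hself, smul_zero]

theorem fderiv_unitCoord_eq_zero_iff {z : Fin 4 → ℂ} (hz : z ∈ algTorus) (v : Fin 4 → ℂ) :
    fderiv ℝ unitCoord z v = 0 ↔ ∃ x : Fin 4 → ℝ, v = fun i => unitCoord z i * x i := by
  have hd : ∀ i, HasFDerivAt (fun w : Fin 4 → ℂ => unitCoord w i)
      ((fderiv ℝ (fun w : ℂ => w / (‖w‖ : ℂ)) (z i)).comp (ContinuousLinearMap.proj i)) z :=
    fun i => HasFDerivAt.comp z (g := fun w : ℂ => w / (‖w‖ : ℂ))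
      (differentiableAt_div_norm (hz i)).hasFDerivAt (hasFDerivAt_apply i z)
  have h := (hasFDerivAt_pi.2 hd).fderiv
  have h' : fderiv ℝ unitCoord z v =
      fun i => fderiv ℝ (fun w : ℂ => w / (‖w‖ : ℂ)) (z i) (v i) := by
    change fderiv ℝ (fun w i => unitCoord w i) z v = _
    rw [h]; rfl
  rw [h', funext_iff]
  simp only [Pi.zero_apply, fderiv_div_norm_eq_zero_iff (hz _)]
  rw [Classical.skolem]
  simp only [funext_iff]; rfl

theorem mem_criticalLocus_iff {V : AffineSubspace ℂ (Fin 4 → ℂ)} (hV : finrank ℂ V.direction = 2)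
    (z : torusPart V) : z ∈ criticalLocus V ↔
      ∃ x : Fin 4 → ℝ, x ≠ 0 ∧ (fun i => (coamoebaMap V z i : ℂ) * x i) ∈ V.direction := by
  set W := V.direction.restrictScalars ℝ
  set f := (fderiv ℝ unitCoord z.1 : (Fin 4 → ℂ) →ₗ[ℝ] (Fin 4 → ℂ))
  have hW : finrank ℝ W = 4 := by
    have := finrank_real_of_complex V.direction
    rw [hV] at this; exact this
  have hrn := LinearMap.finrank_range_add_finrank_ker (f.domRestrict W)
  rw [LinearMap.range_domRestrict, hW] at hrn
  have h1 : z ∈ criticalLocus V ↔ finrank ℝ (W.map f) < 4 := Iff.rfl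
  have h2 : finrank ℝ (W.map f) < 4 ↔ (f.domRestrict W).ker ≠ ⊥ := by
    rw [ne_eq, ← Submodule.finrank_eq_zero (R := ℝ)]; omega
  rw [h1, h2, Submodule.ne_bot_iff]
  have hz := z.2.2
  constructor
  · rintro ⟨⟨w, hw⟩, hk, h0⟩
    obtain ⟨x, hx⟩ := (fderiv_unitCoord_eq_zero_iff hz w).1 hk
    refine ⟨x, ?_, ?_⟩
    · rintro rfl
      exact h0 (Subtype.ext (hx.trans (by ext; simp)))
    · have : w ∈ V.direction := hw
      rw [hx] at this
      exact this
  · rintro ⟨x, h0, hx⟩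
    refine ⟨⟨_, hx⟩, (fderiv_unitCoord_eq_zero_iff hz _).2 ⟨x, rfl⟩, fun h => h0 ?_⟩
    funext i
    have := congrFun (congrArg Subtype.val h) i
    simpa using this

/-! ### The genericity condition -/

/-- The polynomial `Im (M₀₁ M₂₃ conj (M₀₂ M₁₃))` in the real and imaginary parts of the entries of
a `4 × 2` matrix with maximal minors `M_ij`. -/
def minorIm {R : Type*} [CommRing R] (x y : Fin 4 → Fin 2 → R) : R :=
  let mr := fun i j => x i 0 * x j 1 - y i 0 * y j 1 - (x j 0 * x i 1 - y j 0 * y i 1)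
  let mi := fun i j => x i 0 * y j 1 + y i 0 * x j 1 - (x j 0 * y i 1 + y j 0 * x i 1)
  (mr 0 1 * mi 2 3 + mi 0 1 * mr 2 3) * (mr 0 2 * mr 1 3 - mi 0 2 * mi 1 3) -
    (mr 0 1 * mr 2 3 - mi 0 1 * mi 2 3) * (mr 0 2 * mi 1 3 + mi 0 2 * mr 1 3)

theorem map_minorIm {R S : Type*} [CommRing R] [CommRing S] (f : R →+* S)
    (x y : Fin 4 → Fin 2 → R) :
    f (minorIm x y) = minorIm (fun i j => f (x i j)) (fun i j => f (y i j)) := by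
  simp [minorIm]

/-- The `2 × 2` minors of a matrix with two columns. -/
def rowMinor {R : Type*} [CommRing R] {n : Type*} (A : Matrix n (Fin 2) R) (i j : n) : R :=
  A i 0 * A j 1 - A j 0 * A i 1

theorem minorIm_re_im (A : Matrix (Fin 4) (Fin 2) ℂ) :
    minorIm (fun i j => (A i j).re) (fun i j => (A i j).im) =
      (rowMinor A 0 1 * rowMinor A 2 3 *
        (starRingEnd ℂ) (rowMinor A 0 2 * rowMinor A 1 3)).im := by
  simp [minorIm, rowMinor]
  ring

/-- `minorIm` as a polynomial in all the real coordinates of `u ↦ A u + b`. -/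
noncomputable def genericPoly :
    MvPolynomial (((Fin 4 × Fin 2) ⊕ Fin 4) ⊕ ((Fin 4 × Fin 2) ⊕ Fin 4)) ℝ :=
  minorIm (fun i j => MvPolynomial.X (Sum.inl (Sum.inl (i, j))))
    (fun i j => MvPolynomial.X (Sum.inr (Sum.inl (i, j))))

theorem eval_genericPoly (A : Matrix (Fin 4) (Fin 2) ℂ) (b : Fin 4 → ℂ) :
    MvPolynomial.eval (realCoords A b) genericPoly =
      (rowMinor A 0 1 * rowMinor A 2 3 *
        (starRingEnd ℂ) (rowMinor A 0 2 * rowMinor A 1 3)).im := by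
  rw [genericPoly, map_minorIm, ← minorIm_re_im]
  simp [realCoords]

theorem genericPoly_ne_zero : genericPoly ≠ 0 := by
  intro h
  -- Here `p₀₁ = p₀₂ = 1`, `p₂₃ = I - 1` and `p₁₃ = -1`, so the value is `Im (1 - I) = -1`.
  have := eval_genericPoly !![1, 0; 0, 1; 1, 1; 1, Complex.I] 0
  rw [h, map_zero] at this
  simp [rowMinor] at this

/-- Cauchy–Binet for the pair `g, h`: each minor of `A`, times `d = det (g, h)`, is `θ_i θ_j` times
a real minor of `(v, w)`. If `d = 0`, the real minors vanish; otherwise the phases cancel and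
contradict `hA`. -/
theorem mul_eq_mul_of_minors {A : Matrix (Fin 4) (Fin 2) ℂ}
    (hA : (rowMinor A 0 1 * rowMinor A 2 3 *
        (starRingEnd ℂ) (rowMinor A 0 2 * rowMinor A 1 3)).im ≠ 0)
    {θ : Fin 4 → ℂ} (hθ : ∀ i, θ i ≠ 0) {v w : Fin 4 → ℝ} {g h : Fin 2 → ℂ}
    (hv : (fun i => θ i * v i) = A.mulVec g) (hw : (fun i => θ i * w i) = A.mulVec h)
    (i j : Fin 4) : v i * w j = v j * w i := by
  have key : ∀ i j, rowMinor A i j * (g 0 * h 1 - g 1 * h 0) =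
      θ i * θ j * ((v i * w j - v j * w i : ℝ) : ℂ) := by
    intro i j
    have e1 := congrFun hv i
    have e2 := congrFun hv j
    have e3 := congrFun hw i
    have e4 := congrFun hw j
    simp only [Matrix.mulVec, dotProduct, Fin.sum_univ_two] at e1 e2 e3 e4
    push_cast
    have : θ i * θ j * ((v i : ℂ) * w j - v j * w i) =
      (θ i * v i) * (θ j * w j) - (θ j * v j) * (θ i * w i) := by ring
    rw [this, e1, e2, e3, e4, rowMinor]
    ring
  by_cases hd : g 0 * h 1 - g 1 * h 0 = 0
  · have := key i j
    rw [hd, mul_zero, eq_comm, mul_eq_zero, Complex.ofReal_eq_zero] at this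
    have := this.resolve_left (mul_ne_zero (hθ i) (hθ j))
    linarith
  · exfalso
    set d := g 0 * h 1 - g 1 * h 0
    set r : Fin 4 → Fin 4 → ℝ := fun i j => v i * w j - v j * w i
    set q := rowMinor A 0 1 * rowMinor A 2 3 *
        (starRingEnd ℂ) (rowMinor A 0 2 * rowMinor A 1 3)
    set T := θ 0 * θ 1 * θ 2 * θ 3
    -- Both `p₀₁ p₂₃` and `p₀₂ p₁₃` use each index once, so they carry the same factor `T`, which
    -- becomes `|T|²` after conjugating one of them.
    have e : ((Complex.normSq (d * d) : ℝ) : ℂ) * q =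
        ((Complex.normSq T * (r 0 1 * r 2 3 * (r 0 2 * r 1 3)) : ℝ) : ℂ) := by
      have k1 : rowMinor A 0 1 * rowMinor A 2 3 * (d * d) = T * (r 0 1 * r 2 3 : ℝ) := by
        have : rowMinor A 0 1 * rowMinor A 2 3 * (d * d) =
          (rowMinor A 0 1 * d) * (rowMinor A 2 3 * d) := by ring
        rw [this, key, key]; simp only [T, r]; push_cast; ring
      have k2 : rowMinor A 0 2 * rowMinor A 1 3 * (d * d) = T * (r 0 2 * r 1 3 : ℝ) := by
        have : rowMinor A 0 2 * rowMinor A 1 3 * (d * d) =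
          (rowMinor A 0 2 * d) * (rowMinor A 1 3 * d) := by ring
        rw [this, key, key]; simp only [T, r]; push_cast; ring
      have k3 := congrArg (starRingEnd ℂ) k2
      rw [map_mul, map_mul (starRingEnd ℂ) T, Complex.conj_ofReal] at k3
      calc ((Complex.normSq (d * d) : ℝ) : ℂ) * q
          = (rowMinor A 0 1 * rowMinor A 2 3 * (d * d)) *
            ((starRingEnd ℂ) (rowMinor A 0 2 * rowMinor A 1 3) * (starRingEnd ℂ) (d * d)) := by
              rw [← Complex.mul_conj]; ring
        _ = _ := by rw [k1, k3, Complex.ofReal_mul (Complex.normSq T), ← Complex.mul_conj]; push_cast; ring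
    have := congrArg Complex.im e
    rw [Complex.im_ofReal_mul, Complex.ofReal_im, mul_eq_zero] at this
    exact this.elim (fun h0 => hd (by simpa using h0)) hA

theorem direction_eq_mulVec {V : AffineSubspace ℂ (Fin 4 → ℂ)} {A : Matrix (Fin 4) (Fin 2) ℂ}
    {b : Fin 4 → ℂ} (hV : (V : Set (Fin 4 → ℂ)) = Set.range (fun u : Fin 2 → ℂ => A.mulVec u + b))
    {w : Fin 4 → ℂ} (hw : w ∈ V.direction) : ∃ g, w = A.mulVec g := by
  have hb : b ∈ V := by
    rw [← SetLike.mem_coe, hV]; exact ⟨0, by simp⟩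
  have := AffineSubspace.vadd_mem_of_mem_direction hw hb
  rw [← SetLike.mem_coe, hV] at this
  obtain ⟨g, hg⟩ := this
  exact ⟨g, (add_right_cancel hg).symm⟩

/-! ### Intervals -/

/-- For `a, b ≥ 0`, an increasing homeomorphism `(-1/a, 1/b) → ℝ`. -/
noncomputable def stretch (a b t : ℝ) : ℝ :=
  max t 0 / (1 - b * max t 0) + min t 0 / (1 + a * min t 0)

/-- The inverse of `stretch`. -/
noncomputable def shrink (a b s : ℝ) : ℝ :=
  max s 0 / (1 + b * max s 0) + min s 0 / (1 - a * min s 0)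

theorem shrink_stretch {a b t : ℝ} (h1 : 0 < 1 - b * max t 0)
    (h2 : 0 < 1 + a * min t 0) : shrink a b (stretch a b t) = t := by
  rcases le_total 0 t with h | h
  · simp only [max_eq_left h, min_eq_right h] at h1 h2
    have hs : 0 ≤ t / (1 - b * t) := by positivity
    simp only [stretch, shrink, max_eq_left h, min_eq_right h, zero_div, add_zero,
      max_eq_left hs, min_eq_right hs]
    have : 1 + b * (t / (1 - b * t)) = 1 / (1 - b * t) := by field_simp; ring
    rw [this, div_div_div_cancel_right₀ h1.ne', div_one]
  · simp only [max_eq_right h, min_eq_left h] at h1 h2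
    have hs : t / (1 + a * t) ≤ 0 := div_nonpos_of_nonpos_of_nonneg h h2.le
    simp only [stretch, shrink, max_eq_right h, min_eq_left h, zero_div, zero_add,
      max_eq_right hs, min_eq_left hs]
    have : 1 - a * (t / (1 + a * t)) = 1 / (1 + a * t) := by field_simp; ring
    rw [this, div_div_div_cancel_right₀ h2.ne', div_one]

theorem shrink_spec {a b : ℝ} (ha : 0 ≤ a) (hb : 0 ≤ b) (s : ℝ) :
    0 < 1 - b * max (shrink a b s) 0 ∧ 0 < 1 + a * min (shrink a b s) 0 ∧
      stretch a b (shrink a b s) = s := by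
  rcases le_total 0 s with h | h
  · have hp : 0 < 1 + b * s := by positivity
    have hs : 0 ≤ s / (1 + b * s) := by positivity
    have e : shrink a b s = s / (1 + b * s) := by
      simp [shrink, max_eq_left h, min_eq_right h]
    have : 1 - b * (s / (1 + b * s)) = 1 / (1 + b * s) := by field_simp; ring
    simp only [e, stretch, max_eq_left hs, min_eq_right hs, this]
    refine ⟨by positivity, by simp, ?_⟩
    rw [div_div_div_cancel_right₀ hp.ne', div_one]; simp
  · have hp : 0 < 1 - a * s := by nlinarith
    have hs : s / (1 - a * s) ≤ 0 := div_nonpos_of_nonpos_of_nonneg h hp.le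
    have e : shrink a b s = s / (1 - a * s) := by
      simp [shrink, max_eq_right h, min_eq_left h]
    have : 1 + a * (s / (1 - a * s)) = 1 / (1 - a * s) := by field_simp; ring
    simp only [e, stretch, max_eq_right hs, min_eq_left hs, this]
    refine ⟨by simp, by positivity, ?_⟩
    rw [div_div_div_cancel_right₀ hp.ne', div_one]; simp

theorem continuousOn_stretch : ContinuousOn (fun q : ℝ × ℝ × ℝ => stretch q.1 q.2.1 q.2.2)
    {q | 0 < 1 - q.2.1 * max q.2.2 0 ∧ 0 < 1 + q.1 * min q.2.2 0} := by
  unfold stretch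
  refine ContinuousOn.add (ContinuousOn.div (by fun_prop) (by fun_prop) fun q hq => hq.1.ne')
    (ContinuousOn.div (by fun_prop) (by fun_prop) fun q hq => hq.2.ne')

theorem continuousOn_shrink : ContinuousOn (fun q : ℝ × ℝ × ℝ => shrink q.1 q.2.1 q.2.2)
    {q | 0 ≤ q.1 ∧ 0 ≤ q.2.1} := by
  unfold shrink
  refine ContinuousOn.add (ContinuousOn.div (by fun_prop) (by fun_prop) fun q hq => ?_)
    (ContinuousOn.div (by fun_prop) (by fun_prop) fun q hq => ?_)
  · have := mul_nonneg hq.2 (le_max_right q.2.2 0)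
    exact (by linarith : 0 < 1 + q.2.1 * max q.2.2 0).ne'
  · have := mul_nonneg_of_nonpos_of_nonpos (neg_nonpos.2 hq.1) (min_le_right q.2.2 0)
    exact (by linarith : 0 < 1 - q.1 * min q.2.2 0).ne'

/-- The sup norm of the positive part of a vector. -/
noncomputable def posNorm {ι : Type*} [Fintype ι] (w : ι → ℝ) : ℝ := ‖fun i => max (w i) 0‖

theorem posNorm_nonneg {ι : Type*} [Fintype ι] (w : ι → ℝ) : 0 ≤ posNorm w := norm_nonneg _

theorem continuous_posNorm {ι : Type*} [Fintype ι] :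
    Continuous (posNorm : (ι → ℝ) → ℝ) := by
  unfold posNorm; fun_prop

/-- For `t ≥ 0` the nonpositive entries impose nothing, so only the largest positive part matters.
-/
theorem posNorm_mul_lt_one_iff {ι : Type*} [Fintype ι] (w : ι → ℝ) {t : ℝ} (ht : 0 ≤ t) :
    posNorm w * t < 1 ↔ ∀ i, w i * t < 1 := by
  rcases ht.eq_or_lt with rfl | ht
  · simp
  rw [← lt_div_iff₀ ht, posNorm, pi_norm_lt_iff (by positivity)]
  refine forall_congr' fun i => ?_
  rw [Real.norm_of_nonneg (le_max_right _ _), max_lt_iff, lt_div_iff₀ ht]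
  exact and_iff_left (by positivity)

/-- The solution interval is `(-1/a, 1/b)` with `a = posNorm w`, `b = posNorm (-w)`; a zero value
means an infinite end. The `max` and `min` leave only the constraint relevant to the sign of `t`. -/
theorem forall_pos_iff {ι : Type*} [Fintype ι] (w : ι → ℝ) (t : ℝ) :
    (∀ i, 0 < 1 + t * w i) ↔
      0 < 1 - posNorm (-w) * max t 0 ∧ 0 < 1 + posNorm w * min t 0 := by
  rcases le_total 0 t with h | h
  · have := posNorm_mul_lt_one_iff (-w) h
    simp only [max_eq_left h, min_eq_right h, sub_pos, this, mul_zero, add_zero, zero_lt_one,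
      and_true, Pi.neg_apply]
    exact forall_congr' fun i => ⟨fun h => by linarith, fun h => by linarith⟩
  · have := posNorm_mul_lt_one_iff w (neg_nonneg.2 h)
    have e : 0 < 1 + posNorm w * t ↔ posNorm w * -t < 1 :=
      ⟨fun h => by linarith, fun h => by linarith⟩
    simp only [max_eq_right h, min_eq_left h, mul_zero, sub_zero, zero_lt_one, true_and, e, this]
    exact forall_congr' fun i => ⟨fun h => by linarith, fun h => by linarith⟩

/-- The sigmoid function as a homeomorphism from `ℝ` to the open unit interval. -/
noncomputable def sigmoidHomeomorph : ℝ ≃ₜ Set.Ioo (0 : ℝ) 1 :=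
  ((Real.sigmoid_strictMono.orderIso _).trans
    (OrderIso.setCongr _ _ Real.range_sigmoid)).toHomeomorph

/-! ### The fibers -/

/-- `rotate θ x = (θ_i x_i)_i`, as a real-linear map in `x`. -/
noncomputable def rotate (θ : Fin 4 → Circle) : (Fin 4 → ℝ) →ₗ[ℝ] (Fin 4 → ℂ) where
  toFun x i := θ i * x i
  map_add' x y := by ext; simp [mul_add]
  map_smul' c x := by ext; simp; ring

theorem rotate_apply (θ : Fin 4 → Circle) (x : Fin 4 → ℝ) (i : Fin 4) :
    rotate θ x i = θ i * x i := rfl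

theorem rotate_coamoebaMap {V : AffineSubspace ℂ (Fin 4 → ℂ)} (z : torusPart V) :
    rotate (coamoebaMap V z) (fun i => ‖z.1 i‖) = z.1 := by
  funext i
  have : (‖z.1 i‖ : ℂ) ≠ 0 := by simpa using z.2.2 i
  exact div_mul_cancel₀ _ this

theorem norm_rotate {θ : Fin 4 → Circle} {x : Fin 4 → ℝ} (hx : ∀ i, 0 < x i) (i : Fin 4) :
    ‖rotate θ x i‖ = x i := by
  simp [rotate_apply, abs_of_pos (hx i), Circle.norm_coe]

theorem rotate_mem_torusPart {V : AffineSubspace ℂ (Fin 4 → ℂ)} {θ : Fin 4 → Circle}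
    {x : Fin 4 → ℝ} (hx : ∀ i, 0 < x i) (h : rotate θ x ∈ V) : rotate θ x ∈ torusPart V :=
  ⟨h, fun i => by rw [← norm_ne_zero_iff, norm_rotate hx]; exact (hx i).ne'⟩

theorem coamoebaMap_rotate {V : AffineSubspace ℂ (Fin 4 → ℂ)} {θ : Fin 4 → Circle}
    {x : Fin 4 → ℝ} (hx : ∀ i, 0 < x i) (h : rotate θ x ∈ V) :
    coamoebaMap V ⟨rotate θ x, rotate_mem_torusPart hx h⟩ = θ := by
  funext i
  apply Subtype.ext
  change rotate θ x i / (‖rotate θ x i‖ : ℂ) = θ i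
  rw [norm_rotate hx, rotate_apply]
  exact mul_div_cancel_right₀ _ (by simpa using (hx i).ne')

theorem mem_criticalValues_iff {V : AffineSubspace ℂ (Fin 4 → ℂ)}
    (hV : finrank ℂ V.direction = 2) (θ : Fin 4 → Circle) : θ ∈ criticalValues V ↔
      (∃ x, (∀ i, 0 < x i) ∧ rotate θ x ∈ V) ∧ ∃ v ≠ 0, rotate θ v ∈ V.direction := by
  constructor
  · rintro ⟨z, hz, rfl⟩
    refine ⟨⟨fun i => ‖z.1 i‖, fun i => norm_pos_iff.2 (z.2.2 i), ?_⟩,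
      (mem_criticalLocus_iff hV z).1 hz⟩
    rw [rotate_coamoebaMap]
    exact z.2.1
  · rintro ⟨⟨x, hx, h⟩, v, hv⟩
    refine ⟨⟨rotate θ x, rotate_mem_torusPart hx h⟩, (mem_criticalLocus_iff hV _).2 ?_,
      coamoebaMap_rotate hx h⟩
    rw [coamoebaMap_rotate hx h]
    exact ⟨v, hv⟩

/-- The point of the critical locus with argument `θ` and absolute values `x`. -/
noncomputable def criticalPoint {V : AffineSubspace ℂ (Fin 4 → ℂ)} (hV : finrank ℂ V.direction = 2)
    (θ : criticalValues V) (x : Fin 4 → ℝ) (hx : ∀ i, 0 < x i) (h : rotate θ.1 x ∈ V) :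
    criticalLocus V :=
  ⟨⟨rotate θ.1 x, rotate_mem_torusPart hx h⟩, (mem_criticalLocus_iff hV _).2 (by
    rw [coamoebaMap_rotate hx h]; exact ((mem_criticalValues_iff hV _).1 θ.2).2)⟩

theorem criticalProj_criticalPoint {V : AffineSubspace ℂ (Fin 4 → ℂ)}
    (hV : finrank ℂ V.direction = 2)
    (θ : criticalValues V) (x : Fin 4 → ℝ) (hx : ∀ i, 0 < x i) (h : rotate θ.1 x ∈ V) :
    criticalProj V (criticalPoint hV θ x hx h) = θ :=
  Subtype.ext (coamoebaMap_rotate hx h)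

theorem continuous_rotate :
    Continuous fun q : (Fin 4 → Circle) × (Fin 4 → ℝ) => rotate q.1 q.2 := by
  refine continuous_pi fun i => ?_
  simp only [rotate_apply]
  fun_prop

/-- The lines `{x | rotate θ x ∈ V}` depend continuously on the critical value `θ`. -/
theorem exists_continuousOn_line {V : AffineSubspace ℂ (Fin 4 → ℂ)}
    (hV : finrank ℂ V.direction = 2) {θ₀ : Fin 4 → Circle} (hθ₀ : θ₀ ∈ criticalValues V)
    {k : Fin 4} (hk : ∀ x, rotate θ₀ x ∈ V.direction → x k = 0 → x = 0) :
    ∃ (U : Set (Fin 4 → Circle)) (p v : (Fin 4 → Circle) → Fin 4 → ℝ), IsOpen U ∧ θ₀ ∈ U ∧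
      ContinuousOn p U ∧ ContinuousOn v U ∧ ∀ θ ∈ U, (∀ i, 0 < p θ i) ∧
        (θ ∈ criticalValues V → (∀ t : ℝ, (p θ + t • v θ) k = p θ k + t) ∧
          ∀ x, rotate θ x ∈ V ↔ x = p θ + (x k - p θ k) • v θ) := by
  obtain ⟨x₀, hx₀, hx₀V⟩ := ((mem_criticalValues_iff hV _).1 hθ₀).1
  obtain ⟨C, hC⟩ := Submodule.exists_isCompl V.direction
  set Φ : (Fin 4 → ℂ) →ₗ[ℝ] (Fin 4 → ℂ) :=
    (C.subtype.comp ((Submodule.quotientEquivOfIsCompl _ _ hC).toLinearMap.comp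
      V.direction.mkQ)).restrictScalars ℝ
    with hΦ_def
  have hΦ : ∀ w, Φ w = 0 ↔ w ∈ V.direction := by
    intro w; simp [hΦ_def]
  have hVΦ : ∀ w, w ∈ V ↔ Φ w = Φ (rotate θ₀ x₀) := by
    intro w
    rw [← sub_eq_zero, ← map_sub, hΦ, ← AffineSubspace.vsub_right_mem_direction_iff_mem hx₀V]
    rfl
  set c := Φ (rotate θ₀ x₀)
  let N : (Fin 4 → Circle) → (Fin 4 → ℝ) →ₗ[ℝ] (Fin 4 → ℂ) × ℝ := fun θ =>
    (Φ.comp (rotate θ)).prod (LinearMap.proj k)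
  have hN : ∀ θ x, N θ x = (Φ (rotate θ x), x k) := fun _ _ => rfl
  -- Composing with a left inverse at `θ₀` turns the overdetermined system `N θ x = y` into a square
  -- one, which is the identity at `θ₀` and so invertible nearby.
  obtain ⟨L, hL⟩ := (N θ₀).exists_leftInverse_of_injective (by
    rw [LinearMap.ker_eq_bot']
    intro x hx
    rw [hN, Prod.mk_eq_zero, hΦ] at hx
    exact hk x hx.1 hx.2)
  let M : (Fin 4 → Circle) → Matrix (Fin 4) (Fin 4) ℝ := fun θ => LinearMap.toMatrix' (L.comp (N θ))
  have hM : ∀ θ x, (M θ).mulVec x = L (N θ x) := fun θ x => by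
    simp only [M, LinearMap.toMatrix'_mulVec]; rfl
  have hMc : Continuous M := by
    refine continuous_matrix fun i j => ?_
    simp only [M, LinearMap.toMatrix'_apply, LinearMap.comp_apply, hN]
    have h1 : Continuous fun θ : Fin 4 → Circle => rotate θ (Pi.single j 1) :=
      continuous_rotate.comp (Continuous.prodMk_left _)
    have h2 := L.continuous_of_finiteDimensional.comp
      ((Φ.continuous_of_finiteDimensional.comp h1).prodMk
        (continuous_const (y := (Pi.single j 1 : Fin 4 → ℝ) k)))
    exact (continuous_apply i).comp h2
  have hdet : Continuous fun θ => (M θ).det := hMc.matrix_det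
  have hM₀ : M θ₀ = 1 := by simp only [M, hL, LinearMap.toMatrix'_id]
  let U₀ : Set (Fin 4 → Circle) := {θ | (M θ).det ≠ 0}
  have hU₀ : IsOpen U₀ := isOpen_ne_fun hdet continuous_const
  have hinv : ContinuousOn (fun θ => (M θ)⁻¹) U₀ := by
    simp only [Matrix.inv_def, Ring.inverse_eq_inv']
    exact (hdet.continuousOn.inv₀ fun θ hθ => hθ).smul hMc.matrix_adjugate.continuousOn
  have hsolve : ∀ θ ∈ U₀, ∀ x y, L (N θ x) = y → x = (M θ)⁻¹.mulVec y := by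
    rintro θ hθ x y rfl
    rw [← hM, Matrix.mulVec_mulVec, Matrix.nonsing_inv_mul _ (isUnit_iff_ne_zero.2 hθ),
      Matrix.one_mulVec]
  let p : (Fin 4 → Circle) → Fin 4 → ℝ := fun θ => (M θ)⁻¹.mulVec (L (c, x₀ k))
  let v : (Fin 4 → Circle) → Fin 4 → ℝ := fun θ => (M θ)⁻¹.mulVec (L (0, 1))
  have hp : ContinuousOn p U₀ := (Continuous.matrix_mulVec continuous_id
    continuous_const).comp_continuousOn hinv
  have hv : ContinuousOn v U₀ := (Continuous.matrix_mulVec continuous_id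
    continuous_const).comp_continuousOn hinv
  have hpos : IsOpen {x : Fin 4 → ℝ | ∀ i, 0 < x i} := by
    simp only [Set.ofPred_forall]
    exact isOpen_iInter_of_finite fun i => isOpen_lt continuous_const (continuous_apply i)
  have hθ₀U : θ₀ ∈ U₀ := by simp [U₀, hM₀]
  have hp₀ : p θ₀ = x₀ := (hsolve θ₀ hθ₀U x₀ _ rfl).symm
  refine ⟨U₀ ∩ p ⁻¹' {x | ∀ i, 0 < x i}, p, v, hp.isOpen_inter_preimage hU₀ hpos,
    ⟨hθ₀U, by rw [Set.mem_preimage, hp₀]; exact hx₀⟩, hp.mono Set.inter_subset_left,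
    hv.mono Set.inter_subset_left, fun θ hθ => ⟨hθ.2, fun hθc => ?_⟩⟩
  -- Applying `L` may lose equations, so `p θ` and `v θ` solve the original system only where
  -- solutions exist. Criticality of `θ` supplies them: a point `y` and a direction `w` with `w k ≠
  -- 0` reach every value of the `k`-th coordinate.
  obtain ⟨⟨y, hy, hyV⟩, w, hw, hwV⟩ := (mem_criticalValues_iff hV _).1 hθc
  have hwk : w k ≠ 0 := by
    intro h
    apply hw
    have := hsolve θ hθ.1 w 0 (by rw [hN, h, (hΦ _).2 hwV]; exact map_zero L)
    rwa [Matrix.mulVec_zero] at this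
  have hmem : ∀ x, rotate θ x ∈ V → x = p θ + (x k - x₀ k) • v θ := by
    intro x hx
    have hNx : N θ x = (c, x₀ k) + (x k - x₀ k) • ((0, 1) : (Fin 4 → ℂ) × ℝ) := by
      rw [hN, (hVΦ _).1 hx]
      ext <;> simp
    exact (hsolve θ hθ.1 x _ rfl).trans
      (by rw [hNx, map_add, map_smul, Matrix.mulVec_add, Matrix.mulVec_smul])
  have hex : ∀ s, ∃ x, rotate θ x ∈ V ∧ x k = s := by
    intro s
    refine ⟨y + ((s - y k) / w k) • w, ?_, by simp [hwk]⟩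
    rw [hVΦ, map_add, map_add, map_smul, map_smul, (hΦ _).2 hwV, smul_zero, add_zero]
    exact (hVΦ _).1 hyV
  have hline : ∀ t : ℝ, rotate θ (p θ + t • v θ) ∈ V ∧ (p θ + t • v θ) k = x₀ k + t := by
    intro t
    obtain ⟨x, hx, hxk⟩ := hex (x₀ k + t)
    have := hmem x hx
    rw [hxk, add_sub_cancel_left] at this
    rw [← this]
    exact ⟨hx, hxk⟩
  have hpk : p θ k = x₀ k := by simpa using (hline 0).2
  rw [hpk]
  refine ⟨fun t => (hline t).2, fun x => ⟨hmem x, fun h => ?_⟩⟩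
  rw [h]
  exact (hline _).1

/-! ### Local triviality -/

theorem forall_pos_add_smul_iff {ι : Type*} [Fintype ι] {p : ι → ℝ} (hp : ∀ i, 0 < p i)
    (v : ι → ℝ) (t : ℝ) : (∀ i, 0 < (p + t • v) i) ↔
      0 < 1 - posNorm (-(v / p)) * max t 0 ∧ 0 < 1 + posNorm (v / p) * min t 0 := by
  rw [← forall_pos_iff]
  refine forall_congr' fun i => ?_
  have : (p + t • v) i = p i * (1 + t * (v / p) i) := by
    have := (hp i).ne'
    simp only [Pi.add_apply, Pi.smul_apply, smul_eq_mul, Pi.div_apply]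
    field_simp
  rw [this, mul_pos_iff_of_pos_left (hp i)]

theorem continuous_criticalProj (V : AffineSubspace ℂ (Fin 4 → ℂ)) :
    Continuous (criticalProj V) := by
  refine Continuous.subtype_mk (continuous_pi fun i => Continuous.subtype_mk ?_ _) _
  have h : Continuous fun z : criticalLocus V => z.1.1 i :=
    (continuous_apply i).comp (continuous_subtype_val.comp continuous_subtype_val)
  refine h.div (Complex.continuous_ofReal.comp h.norm) fun z => ?_
  simpa using z.1.2.2 i

/-- The coamoeba map is trivial over a set of critical values `θ` over which the lines
`{x | rotate θ x ∈ V}` have a continuous parametrization with a positive base point. -/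
theorem exists_trivialization {V : AffineSubspace ℂ (Fin 4 → ℂ)}
    (hV : finrank ℂ V.direction = 2) {S : Set (criticalValues V)} (hS : IsOpen S) {k : Fin 4}
    {p v : criticalValues V → Fin 4 → ℝ} (hp : ContinuousOn p S) (hv : ContinuousOn v S)
    (hpos : ∀ θ ∈ S, ∀ i, 0 < p θ i) (hk : ∀ θ ∈ S, ∀ t : ℝ, (p θ + t • v θ) k = p θ k + t)
    (hline : ∀ θ ∈ S, ∀ x, rotate θ x ∈ V ↔ x = p θ + (x k - p θ k) • v θ)
    {z₀ : criticalLocus V} :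
    ∃ e : Bundle.Trivialization ℝ (criticalProj V), e.baseSet = S := by
  classical
  let a : criticalValues V → ℝ := fun θ => posNorm (v θ / p θ)
  let b : criticalValues V → ℝ := fun θ => posNorm (-(v θ / p θ))
  have hw : ContinuousOn (fun θ => v θ / p θ) S := continuousOn_pi.2 fun i =>
    (continuousOn_pi.1 hv i).div (continuousOn_pi.1 hp i) fun θ hθ => (hpos θ hθ i).ne'
  have ha : ContinuousOn a S := continuous_posNorm.comp_continuousOn hw
  have hb : ContinuousOn b S := continuous_posNorm.comp_continuousOn hw.neg
  let x : criticalValues V × ℝ → Fin 4 → ℝ := fun q => p q.1 + shrink (a q.1) (b q.1) q.2 • v q.1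
  have hx : ∀ q, q.1 ∈ S → ∀ i, 0 < x q i := fun q hq =>
    have h := shrink_spec (posNorm_nonneg _ : 0 ≤ a q.1) (posNorm_nonneg _ : 0 ≤ b q.1) q.2
    (forall_pos_add_smul_iff (hpos q.1 hq) _ _).2 ⟨h.1, h.2.1⟩
  have hxk : ∀ q, q.1 ∈ S → x q k - p q.1 k = shrink (a q.1) (b q.1) q.2 := fun q hq => by
    simp only [x]
    rw [hk q.1 hq, add_sub_cancel_left]
  have hxV : ∀ q, q.1 ∈ S → rotate q.1 (x q) ∈ V := fun q hq => by
    rw [hline q.1 hq, hxk q hq]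
  have hxc : ContinuousOn x (S ×ˢ Set.univ) := by
    have h1 : Set.MapsTo (Prod.fst : criticalValues V × ℝ → _) (S ×ˢ Set.univ) S := fun q hq => hq.1
    have h2 := fun {X : Type} [TopologicalSpace X] {f : criticalValues V → X}
      (hf : ContinuousOn f S) => hf.comp continuousOn_fst h1
    have h3 : ContinuousOn (fun q : criticalValues V × ℝ => shrink (a q.1) (b q.1) q.2)
        (S ×ˢ Set.univ) := continuousOn_shrink.comp
      ((h2 ha).prodMk ((h2 hb).prodMk continuousOn_snd))
      fun q _ => ⟨posNorm_nonneg _, posNorm_nonneg _⟩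
    exact (h2 hp).add (h3.smul (h2 hv))
  -- By `hk`, `v` has `k`-th entry `1` over `S`, so the `k`-th absolute value reads off the position
  -- on the line.
  let t : criticalLocus V → ℝ := fun z => ‖z.1.1 k‖ - p (criticalProj V z) k
  have hz : ∀ z, criticalProj V z ∈ S →
      (fun i => ‖z.1.1 i‖) = p (criticalProj V z) + t z • v (criticalProj V z) := fun z hz => by
    refine (hline _ hz _).1 ?_
    have : rotate (criticalProj V z).1 (fun i => ‖z.1.1 i‖) = z.1.1 := rotate_coamoebaMap z.1
    rw [this]
    exact z.1.2.1
  have ht : ∀ z, criticalProj V z ∈ S →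
      0 < 1 - b (criticalProj V z) * max (t z) 0 ∧ 0 < 1 + a (criticalProj V z) * min (t z) 0 :=
    fun z hzS => (forall_pos_add_smul_iff (hpos _ hzS) _ _).1 fun i => by
      rw [← hz z hzS]; exact norm_pos_iff.2 (z.1.2.2 i)
  have hproj := continuous_criticalProj V
  -- The inverse must be total; `z₀` is a junk value off `S`.
  let g : criticalValues V × ℝ → criticalLocus V := fun q =>
    if h : q.1 ∈ S then criticalPoint hV q.1 (x q) (hx q h) (hxV q h) else z₀
  have hg : ∀ q, (h : q.1 ∈ S) → g q = criticalPoint hV q.1 (x q) (hx q h) (hxV q h) :=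
    fun q h => dif_pos h
  have hgp : ∀ q, q.1 ∈ S → criticalProj V (g q) = q.1 := fun q h => by
    rw [hg q h, criticalProj_criticalPoint]
  have hgv : ∀ q, q.1 ∈ S → (g q).1.1 = rotate q.1 (x q) := fun q h => by
    rw [hg q h]; rfl
  refine ⟨{
    toFun := fun z => (criticalProj V z,
      stretch (a (criticalProj V z)) (b (criticalProj V z)) (t z))
    invFun := g
    source := criticalProj V ⁻¹' S
    target := S ×ˢ Set.univ
    baseSet := S
    map_source' := fun z hz => ⟨hz, trivial⟩
    map_target' := fun q hq => by rw [Set.mem_preimage, hgp q hq.1]; exact hq.1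
    left_inv' := fun z hzS => ?_
    right_inv' := fun q hq => ?_
    open_source := hS.preimage hproj
    open_target := hS.prod isOpen_univ
    continuousOn_toFun := ?_
    continuousOn_invFun := ?_
    open_baseSet := hS
    source_eq := rfl
    target_eq := rfl
    proj_toFun := fun _ _ => rfl }, rfl⟩
  · apply Subtype.ext
    apply Subtype.ext
    refine (hgv _ (show criticalProj V z ∈ S from hzS)).trans ?_
    simp only [x]
    rw [shrink_stretch (ht z hzS).1 (ht z hzS).2, ← hz z hzS]
    exact rotate_coamoebaMap z.1
  · have h : t (g q) = shrink (a q.1) (b q.1) q.2 := by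
      simp only [t]
      rw [hgp q hq.1, hgv q hq.1, norm_rotate (hx q hq.1), hxk q hq.1]
    rw [hgp q hq.1, h, (shrink_spec (posNorm_nonneg _) (posNorm_nonneg _) _).2.2]
  · have h1 : Set.MapsTo (criticalProj V) (criticalProj V ⁻¹' S) S := fun z hz => hz
    refine hproj.continuousOn.prodMk (continuousOn_stretch.comp
      ((ha.comp hproj.continuousOn h1).prodMk ((hb.comp hproj.continuousOn h1).prodMk ?_))
      fun z hz => ht z hz)
    have h2 : Continuous fun z : criticalLocus V => ‖z.1.1 k‖ :=
      ((continuous_apply k).comp (continuous_subtype_val.comp continuous_subtype_val)).norm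
    exact h2.continuousOn.sub ((continuousOn_pi.1 hp k).comp hproj.continuousOn h1)
  · rw [(Topology.IsInducing.subtypeVal.comp Topology.IsInducing.subtypeVal).continuousOn_iff]
    refine ContinuousOn.congr (f := fun q : criticalValues V × ℝ => (rotate q.1.1 (x q) : Fin 4 → ℂ)) ?_ fun q hq => hgv q hq.1
    exact continuous_rotate.comp_continuousOn
      ((continuous_subtype_val.comp continuous_fst).continuousOn.prodMk hxc)

theorem theorem4 :
    HoldsForGenericPlane (fun V : AffineSubspace ℂ (Fin 4 → ℂ) =>
      IsLocallyTrivialBundle (Set.Ioo (0 : ℝ) 1) (criticalProj V)) := by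
  refine ⟨genericPoly, genericPoly_ne_zero, fun V A b hV hVA hP θ₀ => ?_⟩
  rw [eval_genericPoly] at hP
  obtain ⟨u, hu, huV⟩ := ((mem_criticalValues_iff hV _).1 θ₀.2).2
  obtain ⟨k, huk⟩ := Function.ne_iff.1 hu
  obtain ⟨U, p, v, hU, hθ₀, hp, hv, h⟩ := exists_continuousOn_line hV θ₀.2 (k := k) (by
    -- By genericity `x` is proportional to `u`, and `u k ≠ 0`.
    intro x hx hxk
    obtain ⟨g, hg⟩ := direction_eq_mulVec hVA huV
    obtain ⟨g', hg'⟩ := direction_eq_mulVec hVA hx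
    funext j
    have := mul_eq_mul_of_minors hP (fun i => Circle.coe_ne_zero (θ₀.1 i)) hg hg' k j
    rw [hxk, mul_zero] at this
    exact (mul_eq_zero.1 this).resolve_left huk)
  have hm : Set.MapsTo (Subtype.val : criticalValues V → _) (Subtype.val ⁻¹' U) U := fun _ h => h
  obtain ⟨z₀, hz₀, -⟩ := θ₀.2
  obtain ⟨e, he⟩ := exists_trivialization hV (hU.preimage continuous_subtype_val)
    (hp.comp continuous_subtype_val.continuousOn hm)
    (hv.comp continuous_subtype_val.continuousOn hm) (fun θ hθ => (h θ.1 hθ).1)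
    (fun θ hθ => ((h θ.1 hθ).2 θ.2).1) (fun θ hθ => ((h θ.1 hθ).2 θ.2).2) (z₀ := ⟨z₀, hz₀⟩)
  refine ⟨e.transFiberHomeomorph sigmoidHomeomorph, ?_⟩
  change θ₀ ∈ e.baseSet
  rw [he]
  exact hθ₀
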